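/- For an integer $n\ge 0$ let $\overline{\mathcal{EO}}(n)$ denote the number of partitions of $n$ in which every even part is less than each odd part and in which only the largest even part appears an odd number of times; that is, the largest even part (if there are even parts) appears an odd number of times and every other part appears an even number of times (so if there are no even parts, every part appears an even number of times; in particular $\overline{\mathcal{EO}}(0)=1$). Then $\overline{\mathcal{EO}}(8n+6)$ is almost always divisible by $8$, namely $$\lim_{X\to\infty}\frac{\#\{0\le n\le X:\ \overline{\mathcal{EO}}(8n+6)\equiv 0 \pmod 8\}}{X}=1 .$$ Moreover, $\overline{\mathcal{EO}}(2n)$ is almost always even, namely $$\lim_{X\to\infty}\frac{\#\{0\le n\le X:\ \overline{\mathcal{EO}}(2n)\equiv 0 \pmod 2\}}{X}=1 .$$ Here $n$ runs over integers and $X$ over real numbers. -/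

import Mathlib

open Filter Topology

/-- A partition in which every even part is less than each odd part. -/
def IsEO {n : ℕ} (p : n.Partition) : Prop :=
  ∀ i ∈ p.parts, ∀ j ∈ p.parts, Even i → Odd j → i < j

/-- `i`, a part of `p`, is the largest even part of `p`. -/
def IsLargestEvenPart {n : ℕ} (p : n.Partition) (i : ℕ) : Prop :=
  i ∈ p.parts ∧ Even i ∧ ∀ j ∈ p.parts, Even j → j ≤ i

/-- A partition in which every even part is less than each odd part and in which the largest
even part appears an odd number of times while every other part appears an even number of times.
If there is no even part, every part has to appear an even number of times
(such as `3+3+1+1`, a partition of `8`). -/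
def IsEOBar {n : ℕ} (p : n.Partition) : Prop :=
  IsEO p ∧ ∀ i ∈ p.parts, (Odd (p.parts.count i) ↔ IsLargestEvenPart p i)

instance {n : ℕ} (p : n.Partition) : Decidable (IsEO p) := by
  unfold IsEO; infer_instance

instance {n : ℕ} (p : n.Partition) (i : ℕ) : Decidable (IsLargestEvenPart p i) := by
  unfold IsLargestEvenPart; infer_instance

instance {n : ℕ} (p : n.Partition) : Decidable (IsEOBar p) := by
  unfold IsEOBar; infer_instance

/-- The number of partitions of `n` satisfying `IsEOBar`. -/
def EOBar (n : ℕ) : ℕ :=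
  (Finset.univ.filter fun p : n.Partition => IsEOBar p).card

/-! Write f for `pentagonalSeries ℤ`, which is ∏ (1 - q^n), ψ for `triangleSeries`, a for
`squareSeries` and E for the generating function of EOBar(2n). Removing one copy of the largest even
part leaves pairs of equal parts, and a functional equation in an auxiliary parameter then gives
Andrews's formula E = f(q^2)^3 / f^2. By Gauss's square identity 1 - 2a = f^2 / f(q^2), so E (1 -
2a) = f(q^2)^2. Modulo 2, E ≡ f(q^2)^2 ≡ f(q^4). By the pentagonal number theorem, EOBar(2n) is odd
only when n is four times a pentagonal number, and then 6n + 1 is a square. Modulo 8, E is f(q^2)^2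
(1 + 2a + 4a^2). Splitting off odd exponents twice shows that the coefficient of E at 4k + 3 is -4
times that of f ψ(q^2) ψ(q^4) at k. Since ψ ≡ f^3 modulo 2, this product is f^19 ≡ ψ f(q^16). A
nonzero coefficient at n thus writes 24n + 19 as z^2 + 3x^2. Such values are rare in an arithmetic
progression: an odd prime p ≡ 2 mod 3 dividing z^2 + 3x^2 divides it at least twice, whereas, the
sum of 1/p over these primes being divergent, almost every term is divisible exactly once by one of
them. -/

/-! ### Divergence of the sum of 1/p over primes in a residue class -/

open ArithmeticFunction.vonMangoldt in
/-- The reciprocals of the primes in an invertible residue class are not summable. -/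
theorem not_summable_inv_prime_of_residueClass {q : ℕ} [NeZero q] {a : ZMod q} (ha : IsUnit a) :
    ¬ Summable fun n : ℕ ↦ if n.Prime ∧ (n : ZMod q) = a then (1 / n : ℝ) else 0 := by
  intro H
  set g : ℕ → ℝ := fun n ↦ if n.Prime ∧ (n : ZMod q) = a then (1 / n : ℝ) else 0 with hg
  have hg0 (n : ℕ) : 0 ≤ g n := by
    simp only [hg]; split_ifs <;> positivity
  set c : ℝ := (q.totient : ℝ)⁻¹ with hc
  have hc0 : 0 < c := inv_pos.mpr (mod_cast q.totient.pos_of_neZero)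
  -- The L-series has a simple pole at 1 with residue c. A tail of sum below c / 2 can account for
  -- less than half of it.
  obtain ⟨N, hN⟩ : ∃ N, ∑' n, g (n + N) < c / 2 :=
    ((tendsto_sum_nat_add g).eventually (gt_mem_nhds (half_pos hc0))).exists
  obtain ⟨C, hC⟩ := LSeries_residueClass_lower_bound ha
  have hD := summable_residueClass_non_primes_div a
  set D := ∑' n : ℕ, (if n.Prime then 0 else residueClass a n) / n
  set f : ℕ → ℝ := fun n ↦ if n < N then g n * Real.log n else 0 with hf
  have hfs : Summable f := summable_of_ne_finset_zero (s := Finset.range N) fun n hn ↦ by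
    simp only [hf, Finset.mem_range] at hn ⊢; rw [if_neg hn]
  set K := ∑' n, f n
  set h : ℕ → ℝ := fun n ↦ if n < N then 0 else g n with hh
  have hhs : Summable h := H.of_nonneg_of_le
    (fun n ↦ by simp only [hh]; split_ifs; exacts [le_rfl, hg0 n])
    (fun n ↦ by simp only [hh]; split_ifs; exacts [hg0 n, le_rfl])
  have hhN : ∑' n, h n < c / 2 := by
    rw [← hhs.sum_add_tsum_nat_add N, Finset.sum_eq_zero, zero_add]
    · simpa [hh] using hN
    · intro n hn
      simp [hh, Finset.mem_range.mp hn]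
  -- Nonprimes contribute at most D and primes below N at most K, uniformly in x; only the primes
  -- from N on produce a factor 1 / (x - 1), through log n ≤ n^(x-1) / (x - 1).
  have bound {x : ℝ} (hx : x ∈ Set.Ioc 1 2) :
      ∑' n, residueClass a n / (n : ℝ) ^ x ≤ D + K + (∑' n, h n) / (x - 1) := by
    have hx1 : 0 < x - 1 := sub_pos.mpr hx.1
    rw [← tsum_div_const, ← hD.tsum_add hfs, ← (hD.add hfs).tsum_add (hhs.div_const _)]
    refine Summable.tsum_le_tsum (fun n ↦ ?_) ?_ ((hD.add hfs).add (hhs.div_const _))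
    · have hf0 : 0 ≤ f n := by
        simp only [hf]; split_ifs
        exacts [mul_nonneg (hg0 n) (Real.log_natCast_nonneg n), le_rfl]
      have hh0 : 0 ≤ h n := by
        simp only [hh]; split_ifs
        exacts [le_rfl, hg0 n]
      rcases n.eq_zero_or_pos with rfl | hn
      · simp only [residueClass_apply_zero, zero_div, Nat.cast_zero, div_zero]
        positivity
      have hn' : (0 : ℝ) < n := mod_cast hn
      have hn1 : (1 : ℝ) ≤ n := mod_cast hn
      by_cases hp : n.Prime
      · rw [if_pos hp, zero_div, zero_add]
        by_cases hna : (n : ZMod q) = a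
        · have hgn : g n = 1 / n := if_pos ⟨hp, hna⟩
          have hr : residueClass a n = Real.log n := by
            rw [residueClass, Set.indicator_of_mem (by exact hna),
              ArithmeticFunction.vonMangoldt_apply_prime hp]
          rw [hr]
          by_cases hnN : n < N
          · have : f n = 1 / n * Real.log n := by simp only [hf, if_pos hnN, hgn]
            rw [this]
            have : Real.log n / (n : ℝ) ^ x ≤ Real.log n / (n : ℝ) := by
              refine div_le_div_of_nonneg_left (Real.log_natCast_nonneg n) hn' ?_
              conv_lhs => rw [← Real.rpow_one n]
              exact Real.rpow_le_rpow_of_exponent_le hn1 hx.1.le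
            have e : 1 / (n : ℝ) * Real.log n = Real.log n / n := by ring
            rw [e]
            linarith [div_nonneg hh0 hx1.le]
          · have : h n = 1 / n := by simp only [hh, if_neg hnN, hgn]
            rw [this]
            have h1 : Real.log n ≤ (n : ℝ) ^ (x - 1) / (x - 1) :=
              Real.log_le_rpow_div hn'.le hx1
            have h2 : (n : ℝ) ^ x = (n : ℝ) ^ (x - 1) * n := by
              rw [← Real.rpow_add_one hn'.ne']; simp
            have : Real.log n / (n : ℝ) ^ x ≤ 1 / n / (x - 1) := by
              rw [h2]
              have h3 : 0 < (n : ℝ) ^ (x - 1) := Real.rpow_pos_of_pos hn' _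
              calc _ ≤ (n : ℝ) ^ (x - 1) / (x - 1) / ((n : ℝ) ^ (x - 1) * n) := by gcongr
                _ = _ := by field_simp
            linarith
        · have hr : residueClass a n = 0 := by
            rw [residueClass, Set.indicator_of_notMem (by exact hna)]
          rw [hr, zero_div]
          positivity
      · rw [if_neg hp]
        have : residueClass a n / (n : ℝ) ^ x ≤ residueClass a n / n := by
          refine div_le_div_of_nonneg_left (residueClass_nonneg a _) hn' ?_
          conv_lhs => rw [← Real.rpow_one n]
          exact Real.rpow_le_rpow_of_exponent_le hn1 hx.1.le
        linarith [div_nonneg hh0 hx1.le]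
    · exact LSeries.summable_real_of_abscissaOfAbsConv_lt <|
        (abscissaOfAbsConv_residueClass_le_one a).trans_lt <| mod_cast hx.1
  have key {x : ℝ} (hx : x ∈ Set.Ioc 1 2) : c / 2 ≤ (C + D + K) * (x - 1) := by
    have hx1 : 0 < x - 1 := sub_pos.mpr hx.1
    have h1 := (hC hx).trans (bound hx)
    have h2 : (∑' n, h n) / (x - 1) ≤ c / 2 / (x - 1) := by gcongr
    have h3 : c / 2 / (x - 1) ≤ C + D + K := by
      have : c / (x - 1) = c / 2 / (x - 1) + c / 2 / (x - 1) := by ring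
      linarith
    exact (div_le_iff₀ hx1).mp h3
  have hlim : Tendsto (fun x : ℝ ↦ (C + D + K) * (x - 1)) (𝓝[>] 1) (𝓝 0) := by
    have : Tendsto (fun x : ℝ ↦ (C + D + K) * (x - 1)) (𝓝 1) (𝓝 ((C + D + K) * (1 - 1))) :=
      ((continuous_id.sub continuous_const).const_mul _).tendsto _
    simpa using this.mono_left nhdsWithin_le_nhds
  have hev : ∀ᶠ x : ℝ in 𝓝[>] 1, x ∈ Set.Ioc (1 : ℝ) 2 := Ioc_mem_nhdsGT (by norm_num)
  have := ge_of_tendsto hlim (hev.mono fun x hx ↦ key hx)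
  linarith

/-! ### A sieve by exact divisibility -/

theorem card_filter_range_mul_of_coprime {a b : ℕ} (hab : a.Coprime b) (ha : 0 < a) (hb : 0 < b)
    (p q : ℕ → Prop) [DecidablePred p] [DecidablePred q]
    (hp : ∀ n, p (n % a) ↔ p n) (hq : ∀ n, q (n % b) ↔ q n) :
    ((Finset.range (a * b)).filter fun n ↦ p n ∧ q n).card =
      ((Finset.range a).filter p).card * ((Finset.range b).filter q).card := by
  rw [← Finset.card_product]
  refine Finset.card_bij (fun n _ ↦ (n % a, n % b)) ?_ ?_ ?_
  · intro n hn
    simp only [Finset.mem_filter, Finset.mem_range, Finset.mem_product] at hn ⊢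
    exact ⟨⟨Nat.mod_lt _ ha, (hp n).mpr hn.2.1⟩, Nat.mod_lt _ hb, (hq n).mpr hn.2.2⟩
  · intro n hn m hm h
    simp only [Finset.mem_filter, Finset.mem_range] at hn hm
    have h1 : n ≡ m [MOD a] := congrArg Prod.fst h
    have h2 : n ≡ m [MOD b] := congrArg Prod.snd h
    exact ((Nat.modEq_and_modEq_iff_modEq_mul hab).mp ⟨h1, h2⟩).eq_of_lt_of_lt hn.1 hm.1
  · rintro ⟨x, y⟩ hxy
    simp only [Finset.mem_filter, Finset.mem_range, Finset.mem_product] at hxy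
    obtain ⟨k, hk1, hk2⟩ := Nat.chineseRemainder hab x y
    have e1 : k % (a * b) % a = x := by
      rw [Nat.mod_mul_right_mod, hk1, Nat.mod_eq_of_lt hxy.1.1]
    have e2 : k % (a * b) % b = y := by
      rw [Nat.mod_mul_left_mod, hk2, Nat.mod_eq_of_lt hxy.2.1]
    refine ⟨k % (a * b), ?_, by simp only [e1, e2]⟩
    simp only [Finset.mem_filter, Finset.mem_range]
    refine ⟨Nat.mod_lt _ (Nat.mul_pos ha hb), ?_, ?_⟩
    · rw [← hp, e1]; exact hxy.1.2
    · rw [← hq, e2]; exact hxy.2.2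

theorem card_filter_range_mul_of_periodic {M : ℕ} (p : ℕ → Prop) [DecidablePred p]
    (hp : ∀ n, p (n + M) ↔ p n) (k : ℕ) :
    ((Finset.range (k * M)).filter p).card = k * ((Finset.range M).filter p).card := by
  induction k with
  | zero => simp
  | succ k ih =>
    have hk (n : ℕ) : p (k * M + n) ↔ p n := by
      clear ih
      induction k with
      | zero => simp
      | succ k ih => rw [← ih, ← hp (k * M + n)]; ring_nf
    rw [← Nat.count_eq_card_filter_range] at ih ⊢
    rw [add_mul, one_mul, Nat.count_add, ih]
    simp only [hk, add_mul, one_mul, ← Nat.count_eq_card_filter_range]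

/-- `p` divides `m` exactly once. -/
abbrev DvdOnce (p m : ℕ) : Prop := p ∣ m ∧ ¬ p ^ 2 ∣ m

theorem dvdOnce_iff_of_modEq {p m n : ℕ} (h : m ≡ n [MOD p ^ 2]) : DvdOnce p m ↔ DvdOnce p n := by
  unfold DvdOnce
  rw [h.dvd_iff (dvd_refl _), h.dvd_iff (dvd_pow_self p two_ne_zero)]

/-- As A is invertible modulo p^2, the linear form takes each of the p - 1 residues p, 2p, ..., (p -
1)p, which are the ones divisible by p exactly once. -/
theorem card_not_dvdOnce_le {p A : ℕ} (hp : p.Prime) (hA : A.Coprime p) (B : ℕ) :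
    ((Finset.range (p ^ 2)).filter fun n ↦ ¬ DvdOnce p (A * n + B)).card ≤ p ^ 2 - (p - 1) := by
  have hp2 : 0 < p ^ 2 := pow_pos hp.pos 2
  have hAc : A.Coprime (p ^ 2) := hA.pow_right 2
  have hsol (k : ℕ) : ∃ n < p ^ 2, A * n + B ≡ p * k [MOD p ^ 2] := by
    have hu : IsUnit (A : ZMod (p ^ 2)) := (ZMod.isUnit_iff_coprime A (p ^ 2)).mpr hAc
    have : NeZero (p ^ 2) := ⟨hp2.ne'⟩
    obtain ⟨u, hu⟩ := hu
    refine ⟨((u⁻¹ : (ZMod (p ^ 2))ˣ) * ((p * k : ℕ) - (B : ZMod (p ^ 2))) : ZMod (p ^ 2)).val,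
      ZMod.val_lt _, ?_⟩
    rw [← ZMod.natCast_eq_natCast_iff]
    push_cast
    rw [ZMod.natCast_zmod_val, ← hu, Units.mul_inv_cancel_left]
    ring
  choose s hs hsk using hsol
  have h1 : p - 1 ≤ ((Finset.range (p ^ 2)).filter fun n ↦ DvdOnce p (A * n + B)).card := by
    have : (Finset.Ico 1 p).card = p - 1 := by simp
    rw [← this]
    refine Finset.card_le_card_of_injOn s ?_ ?_
    · intro k hk
      simp only [Finset.coe_Ico, Set.mem_Ico] at hk
      simp only [Finset.coe_filter, Finset.mem_range, Set.mem_ofPred_eq]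
      refine ⟨hs k, ?_⟩
      rw [dvdOnce_iff_of_modEq (hsk k)]
      refine ⟨dvd_mul_right _ _, ?_⟩
      rw [pow_two, Nat.mul_dvd_mul_iff_left hp.pos]
      exact fun h ↦ absurd (Nat.le_of_dvd hk.1 h) (not_le.mpr hk.2)
    · intro k hk l hl hkl
      simp only [Finset.coe_Ico, Set.mem_Ico] at hk hl
      have : p * k ≡ p * l [MOD p ^ 2] := (hsk k).symm.trans (hkl ▸ hsk l)
      rw [pow_two] at this
      exact (Nat.ModEq.mul_left_cancel' hp.ne_zero this).eq_of_lt_of_lt hk.2 hl.2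
  have h2 := Finset.card_filter_add_card_filter_not (s := Finset.range (p ^ 2))
    (fun n ↦ DvdOnce p (A * n + B))
  rw [Finset.card_range] at h2
  omega

/-- The conditions at distinct primes are independent by the Chinese remainder theorem. -/
theorem card_forall_not_dvdOnce_le (A B : ℕ) (T : Finset ℕ)
    (hT : ∀ p ∈ T, p.Prime ∧ A.Coprime p) :
    ((Finset.range (∏ p ∈ T, p ^ 2)).filter fun n ↦ ∀ p ∈ T, ¬ DvdOnce p (A * n + B)).card ≤
      ∏ p ∈ T, (p ^ 2 - (p - 1)) := by
  induction T using Finset.induction_on with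
  | empty => simp
  | insert p T hpT ih =>
    have hp := hT p (Finset.mem_insert_self _ _)
    have hT' : ∀ r ∈ T, r.Prime ∧ A.Coprime r := fun r hr ↦ hT r (Finset.mem_insert_of_mem hr)
    rw [Finset.prod_insert hpT, Finset.prod_insert hpT]
    simp only [Finset.forall_mem_insert]
    have hmod (r n m : ℕ) (h : n ≡ m [MOD r ^ 2]) :
        ¬ DvdOnce r (A * n + B) ↔ ¬ DvdOnce r (A * m + B) :=
      not_congr (dvdOnce_iff_of_modEq ((h.mul_left A).add_right B))
    rw [card_filter_range_mul_of_coprime (p := fun n ↦ ¬ DvdOnce p (A * n + B))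
      (q := fun n ↦ ∀ r ∈ T, ¬ DvdOnce r (A * n + B))]
    · exact Nat.mul_le_mul (card_not_dvdOnce_le hp.1 hp.2 B) (ih hT')
    · refine Nat.Coprime.prod_right fun r hr ↦ Nat.Coprime.pow 2 2 ?_
      exact (Nat.coprime_primes hp.1 (hT' r hr).1).mpr (fun h ↦ hpT (h ▸ hr))
    · exact pow_pos hp.1.pos 2
    · exact Finset.prod_pos fun r hr ↦ pow_pos (hT' r hr).1.pos 2
    · exact fun n ↦ hmod p _ _ (Nat.mod_modEq n _)
    · exact fun n ↦ forall₂_congr fun r hr ↦ hmod r _ _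
        ((Nat.mod_modEq n _).of_dvd (Finset.dvd_prod_of_mem (fun r ↦ r ^ 2) hr))

/-- If `∑ 1 / p` diverges over a set of primes, almost every term of an arithmetic progression
is exactly divisible by some prime in the set. -/
theorem eventually_card_not_dvdOnce_le {A B : ℕ} {P : ℕ → Prop} [DecidablePred P]
    (hP : ∀ p, P p → p.Prime ∧ A.Coprime p)
    (hdiv : ¬ Summable fun n : ℕ ↦ if P n then (1 / n : ℝ) else 0) (S : Set ℕ)
    (hS : ∀ n ∈ S, ∀ p, P p → ¬ DvdOnce p (A * n + B)) {ε : ℝ} (hε : 0 < ε) :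
    ∀ᶠ N : ℕ in atTop, ((S ∩ Set.Iio N).ncard : ℝ) ≤ ε * N := by
  obtain ⟨T, hTP, hTε⟩ : ∃ T : Finset ℕ, (∀ p ∈ T, P p) ∧
      (∏ p ∈ T, (p ^ 2 - (p - 1) : ℝ) / p ^ 2) < ε / 2 := by
    have h0 (n : ℕ) : (0 : ℝ) ≤ if P n then (1 / n : ℝ) else 0 := by split_ifs <;> positivity
    have ht := (not_summable_iff_tendsto_nat_atTop_of_nonneg h0).mp hdiv
    obtain ⟨N, hN⟩ := (ht.eventually_gt_atTop (-2 * Real.log (ε / 2))).exists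
    refine ⟨(Finset.range N).filter P, fun p hp ↦ (Finset.mem_filter.mp hp).2, ?_⟩
    rw [← Finset.sum_filter] at hN
    -- Since p - 1 ≥ p / 2, each factor is at most 1 - 1/(2p) ≤ exp(-1/(2p)).
    calc _ ≤ ∏ p ∈ (Finset.range N).filter P, Real.exp (-(1 / 2) * (1 / p)) := by
          refine Finset.prod_le_prod (fun p hp ↦ ?_) fun p hp ↦ ?_
          · have : (1 : ℝ) ≤ p := mod_cast (hP p (Finset.mem_filter.mp hp).2).1.one_le
            apply div_nonneg <;> nlinarith
          · have h2 : (2 : ℝ) ≤ p := mod_cast (hP p (Finset.mem_filter.mp hp).2).1.two_le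
            refine le_trans ?_ (Real.add_one_le_exp _)
            rw [div_le_iff₀ (by positivity)]
            field_simp
            nlinarith
      _ = Real.exp (-(1 / 2) * ∑ p ∈ (Finset.range N).filter P, (1 / p : ℝ)) := by
          rw [Finset.mul_sum, Real.exp_sum]
      _ < Real.exp (Real.log (ε / 2)) := by
          rw [Real.exp_lt_exp]; linarith
      _ = ε / 2 := Real.exp_log (by positivity)
  have hT : ∀ p ∈ T, p.Prime ∧ A.Coprime p := fun p hp ↦ hP p (hTP p hp)
  set M := ∏ p ∈ T, p ^ 2 with hM
  set c := ((Finset.range M).filter fun n ↦ ∀ p ∈ T, ¬ DvdOnce p (A * n + B)).card with hc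
  have hM0 : 0 < M := Finset.prod_pos fun r hr ↦ pow_pos (hT r hr).1.pos 2
  have hcM : (c : ℝ) ≤ ε / 2 * M := by
    have h1 : (c : ℝ) ≤ ∏ p ∈ T, (p ^ 2 - (p - 1) : ℝ) := by
      have := card_forall_not_dvdOnce_le A B T hT
      refine (Nat.cast_le (α := ℝ).mpr this).trans_eq ?_
      rw [Nat.cast_prod]
      refine Finset.prod_congr rfl fun p hp ↦ ?_
      have h1 := (hT p hp).1.one_le
      have h2 : p - 1 ≤ p ^ 2 := (Nat.sub_le _ _).trans (Nat.le_self_pow two_ne_zero p)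
      push_cast [Nat.cast_sub h2, Nat.cast_sub h1]
      ring
    have hM' : (M : ℝ) = ∏ p ∈ T, (p : ℝ) ^ 2 := by rw [hM]; push_cast; rfl
    rw [Finset.prod_div_distrib, ← hM', div_lt_iff₀ (by exact_mod_cast hM0)] at hTε
    linarith
  have hbound (N : ℕ) : (S ∩ Set.Iio N).ncard ≤ (N / M + 1) * c := by
    rw [hc, ← card_filter_range_mul_of_periodic, ← Set.ncard_coe_finset]
    · refine Set.ncard_le_ncard ?_ (Finset.finite_toSet _)
      rintro n ⟨hn, hnN⟩
      simp only [Finset.coe_filter, Finset.mem_range, Set.mem_ofPred_eq]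
      exact ⟨(Set.mem_Iio.mp hnN).trans (by rw [mul_comm]; exact Nat.lt_mul_div_succ N hM0),
        fun p hp ↦ hS n hn p (hTP p hp)⟩
    · refine fun n ↦ forall₂_congr fun p hp ↦ not_congr (dvdOnce_iff_of_modEq ?_)
      refine Nat.ModEq.add_right B (Nat.ModEq.mul_left A ?_)
      have : p ^ 2 ∣ M := Finset.dvd_prod_of_mem (fun r ↦ r ^ 2) hp
      exact (Nat.modEq_iff_dvd' (Nat.le_add_right _ _)).mpr (by simpa using this) |>.symm
  filter_upwards [eventually_ge_atTop M] with N hN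
  have h1 : ((S ∩ Set.Iio N).ncard : ℝ) ≤ ((N / M : ℕ) + 1) * c := mod_cast hbound N
  have h2 : ((N / M : ℕ) : ℝ) * M ≤ N := mod_cast Nat.div_mul_le_self N M
  have h3 : (M : ℝ) ≤ N := mod_cast hN
  -- N / M + 1 full periods cover the range; for N ≥ M their total length is at most 2N, which is
  -- why the density was made smaller than ε / 2.
  calc _ ≤ ((N / M : ℕ) + 1) * (c : ℝ) := h1
    _ ≤ ((N / M : ℕ) + 1) * (ε / 2 * M) := by gcongr
    _ ≤ ε * N := by nlinarith

/-! ### Values of z^2 + 3x^2 -/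

/-- If p did not divide x, then z / x would be a square root of -3 modulo p, giving an element of
order 3 in a group of order p - 1 ≡ 1 mod 3. So p divides x, hence also z. -/
theorem sq_dvd_sq_add_three_mul_sq {p : ℕ} (hp : p.Prime) (h2 : p ≠ 2) (h3 : p % 3 = 2) {x z : ℤ}
    (h : (p : ℤ) ∣ z ^ 2 + 3 * x ^ 2) : (p : ℤ) ^ 2 ∣ z ^ 2 + 3 * x ^ 2 := by
  have : Fact p.Prime := ⟨hp⟩
  have hx : (p : ℤ) ∣ x := by
    by_contra hx
    have hx' : (x : ZMod p) ≠ 0 := fun h ↦ hx ((ZMod.intCast_zmod_eq_zero_iff_dvd x p).mp h)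
    have hz : (z : ZMod p) ^ 2 + 3 * (x : ZMod p) ^ 2 = 0 := by
      have := (ZMod.intCast_zmod_eq_zero_iff_dvd _ p).mpr h
      push_cast at this
      exact this
    have h20 : (2 : ZMod p) ≠ 0 := by
      intro h
      have : ((2 : ℕ) : ZMod p) = 0 := by exact_mod_cast h
      rw [ZMod.natCast_eq_zero_iff] at this
      exact h2 ((Nat.prime_dvd_prime_iff_eq hp Nat.prime_two).mp this)
    have h30 : (3 : ZMod p) ≠ 0 := by
      intro h
      have : ((3 : ℕ) : ZMod p) = 0 := by exact_mod_cast h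
      rw [ZMod.natCast_eq_zero_iff] at this
      have := (Nat.prime_dvd_prime_iff_eq hp Nat.prime_three).mp this
      omega
    -- a primitive cube root of unity
    set w : ZMod p := (z / x - 1) / 2 with hw
    have hw1 : w ^ 2 + w + 1 = 0 := by
      rw [hw]; field_simp; linear_combination hz
    have hw3 : w ^ 3 = 1 := by linear_combination (w - 1) * hw1
    have hwne : w ≠ 1 := by
      intro h; rw [h] at hw1; apply h30; linear_combination hw1
    have hw0 : w ≠ 0 := by
      intro h; rw [h] at hw1; simp at hw1
    have hord : orderOf w = 3 := orderOf_eq_prime hw3 hwne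
    have := orderOf_dvd_of_pow_eq_one (ZMod.pow_card_sub_one_eq_one hw0)
    rw [hord] at this
    have := hp.two_le
    omega
  have hz : (p : ℤ) ∣ z := by
    have : (p : ℤ) ∣ z ^ 2 := (Int.dvd_add_left (dvd_mul_of_dvd_right (dvd_pow hx two_ne_zero) 3)).mp h
    exact (Nat.prime_iff_prime_int.mp hp).dvd_of_dvd_pow this
  exact dvd_add (pow_dvd_pow_of_dvd hz 2) (dvd_mul_of_dvd_right (pow_dvd_pow_of_dvd hx 2) 3)

/-- The values of a nonconstant linear function that are of the form `z ^ 2 + 3 * x ^ 2`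
have density zero. -/
theorem eventually_card_sq_add_three_mul_sq_le {A B : ℕ} (hA : 2 ≤ A) (S : Set ℕ)
    (hS : ∀ n ∈ S, ∃ x z : ℤ, (A * n + B : ℤ) = z ^ 2 + 3 * x ^ 2) {ε : ℝ} (hε : 0 < ε) :
    ∀ᶠ N : ℕ in atTop, ((S ∩ Set.Iio N).ncard : ℝ) ≤ ε * N := by
  -- The condition A < p discards finitely many primes; it makes p coprime to A and, as A ≥ 2,
  -- excludes p = 2.
  refine eventually_card_not_dvdOnce_le (A := A) (B := B)
    (P := fun p ↦ A < p ∧ p.Prime ∧ (p : ZMod 3) = 2) ?_ ?_ S ?_ hε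
  · rintro p ⟨h1, h2, -⟩
    exact ⟨h2, (Nat.coprime_of_lt_prime (by omega) h1 h2).symm⟩
  · intro h
    refine not_summable_inv_prime_of_residueClass (q := 3) (a := 2) (by decide) ?_
    refine (summable_congr_cofinite ?_).mp h
    rw [Nat.cofinite_eq_atTop]
    filter_upwards [eventually_gt_atTop A] with n hn
    simp [hn]
  · rintro n hn p ⟨h1, h2, h3⟩ ⟨hd, hnd⟩
    obtain ⟨x, z, hxz⟩ := hS n hn
    have h3' : p % 3 = 2 := by
      have : ((p : ℕ) : ZMod 3) = ((2 : ℕ) : ZMod 3) := by exact_mod_cast h3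
      exact (ZMod.natCast_eq_natCast_iff _ _ _).mp this
    apply hnd
    have hc : ((A * n + B : ℕ) : ℤ) = z ^ 2 + 3 * x ^ 2 := by push_cast; exact hxz
    have := sq_dvd_sq_add_three_mul_sq h2 (by omega) h3' (hc ▸ Int.natCast_dvd_natCast.mpr hd)
    rw [← hc] at this
    exact_mod_cast this

/-! ### Shanks's finite identities -/

section Shanks

open Finset

variable {R : Type*} [CommRing R] (x : R)

/-- Shanks's finite form of Gauss's identity `∑ (-1) ^ n * x ^ n ^ 2 = ∏ (1 - x ^ n) / (1 + x ^ n)`,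
summed over all integers `n`. -/
theorem prod_one_add_mul_sum_square (n : ℕ) :
    (∏ j ∈ range n, (1 + x ^ (j + 1))) * (1 - 2 * ∑ s ∈ range n, (-1) ^ s * x ^ ((s + 1) ^ 2)) =
      ∏ j ∈ range n, (1 - x ^ (j + 1)) -
        2 * ∑ s ∈ range n, (-1) ^ s * (∏ j ∈ Ico (s + 1) n, (1 - x ^ (j + 1))) *
          (∏ j ∈ range s, (1 + x ^ (j + 1))) * x ^ ((s + 1) * (n + 1)) := by
  induction n with
  | zero => simp
  | succ n ih =>
    set A : ℕ → R := fun s ↦ ∏ j ∈ Ico s n, (1 - x ^ (j + 1)) with hA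
    set B : ℕ → R := fun s ↦ ∏ j ∈ range s, (1 + x ^ (j + 1)) with hB
    have hAs {s : ℕ} (hs : s < n) : A s = (1 - x ^ (s + 1)) * A (s + 1) :=
      prod_eq_prod_Ico_succ_bot hs _
    have hBs (s : ℕ) : B (s + 1) = B s * (1 + x ^ (s + 1)) := prod_range_succ _ _
    -- The change of each summand from n to n + 1, after scaling the old one by the new factor, is a
    -- consecutive difference in s.
    have htel : ∑ s ∈ range n, ((-1) ^ s * (∏ j ∈ Ico (s + 1) (n + 1), (1 - x ^ (j + 1))) * B s *
          x ^ ((s + 1) * (n + 1 + 1)) -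
        (1 + x ^ (n + 1)) * ((-1) ^ s * A (s + 1) * B s * x ^ ((s + 1) * (n + 1)))) =
        ∑ s ∈ range n, ((-1) ^ (s + 1) * (A (s + 1) * B (s + 1) * x ^ ((s + 1 + 1) * (n + 1))) -
          (-1) ^ s * (A s * B s * x ^ ((s + 1) * (n + 1)))) := by
      refine sum_congr rfl fun s hs ↦ ?_
      rw [mem_range] at hs
      rw [prod_Ico_succ_top (by omega), hAs hs, hBs]
      simp only [hA]
      ring
    rw [sum_range_sub (fun s ↦ (-1) ^ s * (A s * B s * x ^ ((s + 1) * (n + 1)))), sum_sub_distrib,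
      ← mul_sum] at htel
    have hA0 : A 0 = ∏ j ∈ range n, (1 - x ^ (j + 1)) := by simp only [hA, range_eq_Ico]
    have hAn : A n = 1 := by simp [hA]
    rw [sum_range_succ, sum_range_succ, prod_range_succ, prod_range_succ, ← hA0]
    rw [← hA0] at ih
    simp only [Ico_self, prod_empty] at htel ⊢
    rw [hAn] at htel
    simp only [hA, hB] at ih htel ⊢
    linear_combination (1 + x ^ (n + 1)) * ih + 2 * htel

/-- Shanks's finite form of Gauss's identity
`∑ x ^ (n * (n + 1) / 2) = ∏ (1 - x ^ (2 * n)) / (1 - x ^ (2 * n - 1))`. -/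
theorem prod_one_sub_odd_mul_sum_triangle (n : ℕ) :
    (∏ j ∈ range n, (1 - x ^ (2 * j + 1))) * ∑ k ∈ range (2 * n), x ^ (k * (k + 1) / 2) =
      ∑ s ∈ range n, (∏ j ∈ Ico s n, (1 - x ^ (2 * j + 2))) *
        (∏ j ∈ range s, (1 - x ^ (2 * j + 1))) * x ^ (s * (2 * n + 1)) := by
  induction n with
  | zero => simp
  | succ n ih =>
    set U : ℕ → R := fun s ↦ ∏ j ∈ Ico s n, (1 - x ^ (2 * j + 2)) with hU
    set O : ℕ → R := fun s ↦ ∏ j ∈ range s, (1 - x ^ (2 * j + 1)) with hO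
    have hUs {s : ℕ} (hs : s < n) : U s = (1 - x ^ (2 * s + 2)) * U (s + 1) :=
      prod_eq_prod_Ico_succ_bot hs _
    have hOs (s : ℕ) : O (s + 1) = O s * (1 - x ^ (2 * s + 1)) := prod_range_succ _ _
    -- Again a telescoping difference; the factor 1 - x^(2s) makes the boundary term at s = 0
    -- vanish.
    have htel : ∑ s ∈ range n, ((∏ j ∈ Ico s (n + 1), (1 - x ^ (2 * j + 2))) * O s *
          x ^ (s * (2 * (n + 1) + 1)) -
        (1 - x ^ (2 * n + 1)) * (U s * O s * x ^ (s * (2 * n + 1)))) =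
        ∑ s ∈ range n, ((1 - x ^ (2 * (s + 1))) * U (s + 1) * O (s + 1) *
            x ^ ((s + 1) * (2 * n + 1)) -
          (1 - x ^ (2 * s)) * U s * O s * x ^ (s * (2 * n + 1))) := by
      refine sum_congr rfl fun s hs ↦ ?_
      rw [mem_range] at hs
      rw [prod_Ico_succ_top (by omega), hUs hs, hOs]
      have : (∏ j ∈ Ico s n, (1 - x ^ (2 * j + 2))) = U s := rfl
      rw [this, hUs hs]
      ring
    rw [sum_range_sub (fun s ↦ (1 - x ^ (2 * s)) * U s * O s * x ^ (s * (2 * n + 1))),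
      sum_sub_distrib, ← mul_sum] at htel
    have hUn : U n = 1 := by simp [hU]
    rw [hUn] at htel
    have e1 : 2 * n * (2 * n + 1) / 2 = n * (2 * n + 1) :=
      Nat.div_eq_of_eq_mul_right two_pos (by ring)
    have e2 : (2 * n + 1) * (2 * n + 1 + 1) / 2 = (n + 1) * (2 * n + 1) :=
      Nat.div_eq_of_eq_mul_right two_pos (by ring)
    rw [sum_range_succ, prod_range_succ, show 2 * (n + 1) = 2 * n + 1 + 1 by ring, sum_range_succ,
      sum_range_succ, e1, e2]
    simp only [Nat.Ico_succ_singleton, prod_singleton]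
    rw [show 2 * (n + 1) = 2 * n + 1 + 1 by ring] at htel
    linear_combination (1 - x ^ (2 * n + 1)) * ih - htel

end Shanks

/-! ### Gauss's identities for squares and triangular numbers -/

namespace PowerSeries

open WithPiTopology Finset

/-- The theta series `∑ (-1) ^ (s + 1) * X ^ s ^ 2` over positive integers `s`. -/
noncomputable def squareSeries : ℤ⟦X⟧ :=
  mk fun n ↦ if IsSquare n ∧ n ≠ 0 then (-1) ^ (n + 1) else 0

/-- The theta series `∑ X ^ (k * (k + 1) / 2)` over natural numbers `k`. -/
noncomputable def triangleSeries : ℤ⟦X⟧ :=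
  mk fun n ↦ if IsSquare (8 * n + 1) then 1 else 0

theorem hasSum_squareSeries :
    HasSum (fun s : ℕ ↦ (-1) ^ s * X ^ ((s + 1) ^ 2)) squareSeries := by
  have hinj : Function.Injective fun s : ℕ ↦ (s + 1) ^ 2 := fun a b h ↦ by
    simpa using Nat.pow_left_injective two_ne_zero h
  have h := squareSeries.hasSum_of_monomials_self
  rw [← hinj.hasSum_iff] at h
  · convert h using 2 with s
    have hs : coeff ((s + 1) ^ 2) squareSeries = (-1) ^ s := by
      rw [squareSeries, coeff_mk, if_pos ⟨⟨s + 1, pow_two _⟩, by positivity⟩]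
      rcases Nat.even_or_odd s with h | h
      · rw [h.neg_one_pow, Even.neg_one_pow]
        exact ((h.add_one).pow).add_one
      · rw [h.neg_one_pow, Odd.neg_one_pow]
        exact (h.add_one.pow_of_ne_zero two_ne_zero).add_one
    simp only [Function.comp_apply, hs, monomial_eq_C_mul_X_pow]
    simp
  · intro n hn
    have : coeff n squareSeries = 0 := by
      rw [squareSeries, coeff_mk, if_neg]
      rintro ⟨⟨r, hr⟩, h0⟩
      apply hn
      obtain ⟨s, rfl⟩ := Nat.exists_eq_succ_of_ne_zero (show r ≠ 0 by rintro rfl; simp_all)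
      exact ⟨s, by simp only [hr]; rw [pow_two]⟩
    rw [this, map_zero]

theorem isSquare_eight_mul_add_one_iff {n : ℕ} :
    IsSquare (8 * n + 1) ↔ ∃ k, k * (k + 1) / 2 = n := by
  constructor
  · rintro ⟨r, hr⟩
    obtain ⟨k, rfl⟩ : Odd r := by
      have : Odd (r * r) := by rw [← hr]; exact ⟨4 * n, by ring⟩
      exact (Nat.odd_mul.mp this).1
    exact ⟨k, Nat.div_eq_of_eq_mul_right two_pos (by linarith)⟩
  · rintro ⟨k, rfl⟩
    obtain ⟨t, ht⟩ := Nat.even_mul_succ_self k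
    rw [ht, ← two_mul, Nat.mul_div_cancel_left _ two_pos]
    exact ⟨2 * k + 1, by linarith⟩

theorem hasSum_triangleSeries :
    HasSum (fun k : ℕ ↦ (X : ℤ⟦X⟧) ^ (k * (k + 1) / 2)) triangleSeries := by
  have hinj : Function.Injective fun k : ℕ ↦ k * (k + 1) / 2 := by
    refine StrictMono.injective (strictMono_nat_of_lt_succ fun k ↦ ?_)
    have : (k + 1) * (k + 1 + 1) = k * (k + 1) + (k + 1) * 2 := by ring
    rw [this, Nat.add_mul_div_right _ _ two_pos]
    omega
  have h := triangleSeries.hasSum_of_monomials_self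
  rw [← hinj.hasSum_iff] at h
  · convert h using 2 with k
    have hs : coeff (k * (k + 1) / 2) triangleSeries = 1 := by
      rw [triangleSeries, coeff_mk, if_pos (isSquare_eight_mul_add_one_iff.mpr ⟨k, rfl⟩)]
    simp only [Function.comp_apply, hs, monomial_eq_C_mul_X_pow]
    simp
  · intro n hn
    have : coeff n triangleSeries = 0 := by
      rw [triangleSeries, coeff_mk, if_neg]
      exact fun h ↦ hn (isSquare_eight_mul_add_one_iff.mp h)
    rw [this, map_zero]

theorem tendsto_expand {ι : Type*} {l : Filter ι} {u : ι → ℤ⟦X⟧} {g : ℤ⟦X⟧} {p : ℕ} (hp : p ≠ 0)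
    (h : Tendsto u l (𝓝 g)) : Tendsto (fun i ↦ expand p hp (u i)) l (𝓝 (expand p hp g)) := by
  rw [tendsto_iff_coeff_tendsto] at h ⊢
  intro d
  simp only [coeff_expand]
  split_ifs
  · exact h _
  · exact tendsto_const_nhds

theorem tendsto_zero_of_X_pow_dvd {u : ℕ → ℤ⟦X⟧} (h : ∀ n, X ^ n ∣ u n) :
    Tendsto u atTop (𝓝 0) := by
  rw [tendsto_iff_coeff_tendsto]
  refine fun d ↦ tendsto_atTop_of_eventually_const (i₀ := d + 1) fun n hn ↦ ?_
  rw [X_pow_dvd_iff.mp (h n) d (by omega), map_zero]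

theorem tendsto_prod_one_sub_X_pow :
    Tendsto (fun n ↦ ∏ j ∈ range n, (1 - X ^ (j + 1) : ℤ⟦X⟧)) atTop (𝓝 (pentagonalSeries ℤ)) :=
  (hasProd_one_sub_X_pow ℤ).tendsto_prod_nat

theorem tendsto_prod_one_sub_X_pow_even :
    Tendsto (fun n ↦ ∏ j ∈ range n, (1 - X ^ (2 * j + 2) : ℤ⟦X⟧)) atTop
      (𝓝 (expand 2 two_ne_zero (pentagonalSeries ℤ))) := by
  convert tendsto_expand two_ne_zero tendsto_prod_one_sub_X_pow using 2 with n
  simp only [map_prod, map_sub, map_one, map_pow, expand_X, ← pow_mul, mul_add, mul_one]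

theorem prod_odd_mul_prod_even (n : ℕ) :
    (∏ j ∈ range n, (1 - X ^ (2 * j + 1) : ℤ⟦X⟧)) * ∏ j ∈ range n, (1 - X ^ (2 * j + 2)) =
      ∏ j ∈ range (2 * n), (1 - X ^ (j + 1)) := by
  induction n with
  | zero => simp
  | succ n ih =>
    rw [show 2 * (n + 1) = 2 * n + 1 + 1 by ring, prod_range_succ, prod_range_succ,
      prod_range_succ, prod_range_succ, ← ih]
    ring

theorem tendsto_prod_odd_mul_prod_even :
    Tendsto (fun n ↦ (∏ j ∈ range n, (1 - X ^ (2 * j + 1) : ℤ⟦X⟧)) *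
      ∏ j ∈ range n, (1 - X ^ (2 * j + 2))) atTop (𝓝 (pentagonalSeries ℤ)) := by
  simp only [prod_odd_mul_prod_even]
  exact tendsto_prod_one_sub_X_pow.comp (tendsto_id.const_mul_atTop' two_pos)

/-- **Gauss's square number identity**. -/
theorem one_sub_two_mul_squareSeries_mul :
    (1 - 2 * squareSeries) * expand 2 two_ne_zero (pentagonalSeries ℤ) =
      pentagonalSeries ℤ ^ 2 := by
  have h1 := ((hasSum_squareSeries.tendsto_sum_nat.const_mul 2).const_sub 1).mul
    tendsto_prod_one_sub_X_pow_even
  -- Multiplying Shanks's identity by ∏ (1 - X^j) turns ∏ (1 + X^j) into ∏ (1 - X^(2j)). The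
  -- remaining terms have order at least n + 1.
  have herr : Tendsto (fun n ↦ (∏ j ∈ range n, (1 - X ^ (j + 1) : ℤ⟦X⟧)) *
      (2 * ∑ s ∈ range n, (-1) ^ s * (∏ j ∈ Ico (s + 1) n, (1 - X ^ (j + 1) : ℤ⟦X⟧)) *
          (∏ j ∈ range s, (1 + X ^ (j + 1))) * X ^ ((s + 1) * (n + 1)))) atTop (𝓝 0) := by
    refine tendsto_zero_of_X_pow_dvd fun n ↦ dvd_mul_of_dvd_right (dvd_mul_of_dvd_right ?_ _) _
    refine dvd_sum fun s _ ↦ dvd_mul_of_dvd_right (pow_dvd_pow _ ?_) _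
    nlinarith
  have h2 := (tendsto_prod_one_sub_X_pow.mul tendsto_prod_one_sub_X_pow).sub herr
  rw [sub_zero, ← pow_two] at h2
  refine tendsto_nhds_unique h1 (h2.congr fun n ↦ ?_)
  rw [← mul_sub, ← prod_one_add_mul_sum_square, ← mul_assoc, ← prod_mul_distrib, mul_comm]
  congr 1
  exact prod_congr rfl fun j _ ↦ by ring

/-- **Gauss's triangular number identity**. -/
theorem pentagonalSeries_mul_triangleSeries :
    pentagonalSeries ℤ * triangleSeries = expand 2 two_ne_zero (pentagonalSeries ℤ) ^ 2 := by
  have h0 : Tendsto (fun n ↦ ∑ k ∈ range (2 * n), (X : ℤ⟦X⟧) ^ (k * (k + 1) / 2)) atTop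
      (𝓝 triangleSeries) :=
    hasSum_triangleSeries.tendsto_sum_nat.comp (tendsto_id.const_mul_atTop' two_pos)
  have h1 := tendsto_prod_odd_mul_prod_even.mul h0
  -- The summand s = 0 is the main term ∏ (1 - X^(2j+2)); the others have order above n.
  have herr : Tendsto (fun n ↦ (∏ j ∈ range n, (1 - X ^ (2 * j + 2) : ℤ⟦X⟧)) *
      ∑ s ∈ range n, if s = 0 then 0 else (∏ j ∈ Ico s n, (1 - X ^ (2 * j + 2))) *
        (∏ j ∈ range s, (1 - X ^ (2 * j + 1))) * X ^ (s * (2 * n + 1))) atTop (𝓝 0) := by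
    refine tendsto_zero_of_X_pow_dvd fun n ↦ dvd_mul_of_dvd_right ?_ _
    refine dvd_sum fun s _ ↦ ?_
    split_ifs with hs
    · exact dvd_zero _
    · refine dvd_mul_of_dvd_right (pow_dvd_pow _ ?_) _
      have : 1 ≤ s := Nat.one_le_iff_ne_zero.mpr hs
      nlinarith
  have h2 := (tendsto_prod_one_sub_X_pow_even.mul tendsto_prod_one_sub_X_pow_even).add herr
  rw [add_zero, ← pow_two] at h2
  refine tendsto_nhds_unique h1 (h2.congr' ?_)
  filter_upwards [eventually_gt_atTop 0] with n hn
  rw [← mul_add, mul_comm (∏ j ∈ range n, (1 - X ^ (2 * j + 1) : ℤ⟦X⟧)), mul_assoc,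
    prod_one_sub_odd_mul_sum_triangle]
  congr 1
  obtain ⟨m, rfl⟩ := Nat.exists_eq_succ_of_ne_zero hn.ne'
  rw [sum_range_succ', sum_range_succ', if_pos rfl, add_zero, add_comm]
  congr 1
  simp

end PowerSeries

/-! ### Decomposition of the partitions into pairs and a largest even part -/

/-- `i` may occur as a pair of equal parts in an `IsEOBar` partition whose largest even part is
`2 * m` (with `m = 0` if there is no even part). -/
abbrev IsPairPart (m i : ℕ) : Prop := (Even i → i ≤ 2 * m) ∧ (Odd i → 2 * m < i)

/-- Two copies of a multiset, together with `2 * m` if this is not zero. -/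
def doubleAdd (m : ℕ) (s : Multiset ℕ) : Multiset ℕ := 2 • s + if m = 0 then 0 else {2 * m}

theorem count_doubleAdd (m : ℕ) (s : Multiset ℕ) (i : ℕ) :
    (doubleAdd m s).count i = 2 * s.count i + if m ≠ 0 ∧ i = 2 * m then 1 else 0 := by
  unfold doubleAdd
  by_cases hm : m = 0 <;> simp [hm, Multiset.count_singleton]

theorem mem_doubleAdd {m : ℕ} {s : Multiset ℕ} {i : ℕ} :
    i ∈ doubleAdd m s ↔ i ∈ s ∨ (m ≠ 0 ∧ i = 2 * m) := by
  rw [← Multiset.count_pos, count_doubleAdd, ← Multiset.count_pos]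
  split_ifs with h <;> simp [h]

theorem sum_doubleAdd (m : ℕ) (s : Multiset ℕ) : (doubleAdd m s).sum = 2 * s.sum + 2 * m := by
  unfold doubleAdd
  by_cases hm : m = 0 <;> simp [hm, two_nsmul, two_mul]

theorem exists_isLargestEvenPart {n : ℕ} {p : n.Partition} {i : ℕ} (hi : i ∈ p.parts)
    (he : Even i) : ∃ j, IsLargestEvenPart p j := by
  obtain ⟨j, hj, hmax⟩ := (p.parts.toFinset.filter Even).exists_max_image id
    ⟨i, by simp [hi, he]⟩
  simp only [Finset.mem_filter, Multiset.mem_toFinset, id] at hj hmax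
  exact ⟨j, hj.1, hj.2, fun k hk hke ↦ hmax k ⟨hk, hke⟩⟩

theorem isLargestEvenPart_iff_of_parts_eq {n m : ℕ} {p : n.Partition} {s : Multiset ℕ}
    (hp : p.parts = doubleAdd m s) (hs : ∀ i ∈ s, IsPairPart m i) (i : ℕ) :
    IsLargestEvenPart p i ↔ m ≠ 0 ∧ i = 2 * m := by
  have hle (j : ℕ) (hj : j ∈ p.parts) (hje : Even j) : j ≤ 2 * m := by
    rw [hp, mem_doubleAdd] at hj
    rcases hj with hj | hj
    · exact (hs j hj).1 hje
    · exact hj.2.le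
  constructor
  · rintro ⟨h1, h2, h3⟩
    have hi0 := p.parts_pos h1
    have h4 := hle i h1 h2
    have hm : m ≠ 0 := by omega
    exact ⟨hm, le_antisymm h4 (h3 _ (by rw [hp, mem_doubleAdd]; exact .inr ⟨hm, rfl⟩)
      (even_two_mul m))⟩
  · rintro ⟨hm, rfl⟩
    exact ⟨by rw [hp, mem_doubleAdd]; exact .inr ⟨hm, rfl⟩, even_two_mul m, hle⟩

theorem isEOBar_of_parts_eq {n m : ℕ} {p : n.Partition} {s : Multiset ℕ}
    (hp : p.parts = doubleAdd m s) (hs : ∀ i ∈ s, IsPairPart m i) : IsEOBar p := by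
  refine ⟨fun i hi j hj hie hjo ↦ ?_, fun i _ ↦ ?_⟩
  · rw [hp, mem_doubleAdd] at hi hj
    have h1 : i ≤ 2 * m := hi.elim (fun h ↦ (hs i h).1 hie) fun h ↦ h.2.le
    have h2 : 2 * m < j := hj.elim (fun h ↦ (hs j h).2 hjo) fun h ↦
      absurd hjo (by rw [h.2]; simp)
    omega
  · rw [isLargestEvenPart_iff_of_parts_eq hp hs, hp, count_doubleAdd]
    split_ifs with h <;> simp [h]

theorem IsEOBar.exists_parts_eq {n : ℕ} {p : n.Partition} (hp : IsEOBar p) :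
    ∃ m s, p.parts = doubleAdd m s ∧ ∀ i ∈ s, IsPairPart m i := by
  obtain ⟨m, hm⟩ : ∃ m, ∀ i, IsLargestEvenPart p i ↔ m ≠ 0 ∧ i = 2 * m := by
    by_cases h : ∃ j, IsLargestEvenPart p j
    · obtain ⟨j, hj⟩ := h
      obtain ⟨m, hm⟩ := hj.2.1
      have hj0 := p.parts_pos hj.1
      refine ⟨m, fun i ↦ ⟨fun hi ↦ ⟨by omega, ?_⟩, ?_⟩⟩
      · rw [le_antisymm (hj.2.2 i hi.1 hi.2.1) (hi.2.2 j hj.1 hj.2.1), hm, two_mul]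
      · rintro ⟨-, rfl⟩
        rwa [two_mul, ← hm]
    · exact ⟨0, fun i ↦ ⟨fun hi ↦ absurd ⟨i, hi⟩ h, fun hi ↦ absurd rfl hi.1⟩⟩
  -- Halving the multiplicities, rounded down, loses one copy exactly where the multiplicity is odd,
  -- that is at 2m.
  set s : Multiset ℕ :=
    Finsupp.toMultiset ((Multiset.toFinsupp p.parts).mapRange (· / 2) rfl) with hs
  have hsc (i : ℕ) : s.count i = p.parts.count i / 2 := by
    rw [hs, Finsupp.count_toMultiset]; simp
  have hmem (i : ℕ) (hi : i ∈ s) : i ∈ p.parts := by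
    rw [← Multiset.count_pos] at hi ⊢
    have := hsc i
    omega
  refine ⟨m, s, ?_, fun i hi ↦ ⟨fun he ↦ ?_, fun ho ↦ ?_⟩⟩
  · ext i
    rw [count_doubleAdd, hsc]
    have hmi := hm i
    by_cases hi : i ∈ p.parts
    · have := hp.2 i hi
      split_ifs with h
      · have := Nat.odd_iff.mp (this.mpr (hmi.mpr h))
        omega
      · have := Nat.not_odd_iff.mp (mt this.mp (mt hmi.mp h))
        omega
    · rw [Multiset.count_eq_zero_of_notMem hi, if_neg (fun h ↦ hi (hmi.mpr h).1)]
  · obtain ⟨j, hj⟩ := exists_isLargestEvenPart (hmem i hi) he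
    have := hj.2.2 i (hmem i hi) he
    rwa [((hm j).mp hj).2] at this
  · by_cases hm0 : m = 0
    · rw [hm0]; exact ho.pos
    · have := (hm (2 * m)).mpr ⟨hm0, rfl⟩
      exact hp.1 _ this.1 i (hmem i hi) this.2.1 ho

/-- An `IsEOBar` partition of `2 * n` consists of its largest even part `2 * m` and of pairs. -/
theorem eoBar_two_mul (n : ℕ) :
    EOBar (2 * n) =
      ∑ m ∈ Finset.range (n + 1), (Nat.Partition.restricted (n - m) (IsPairPart m)).card := by
  rw [← Finset.card_sigma, EOBar]
  have key (a : Σ m, (n - m).Partition)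
      (ha : a ∈ (Finset.range (n + 1)).sigma fun m ↦
        Nat.Partition.restricted (n - m) (IsPairPart m)) :
      a.1 ≤ n ∧ ∀ i ∈ a.2.parts, IsPairPart a.1 i := by
    simp only [Finset.mem_sigma, Finset.mem_range, Nat.Partition.restricted, Finset.mem_filter,
      Finset.mem_univ, true_and] at ha
    exact ⟨by omega, ha.2⟩
  symm
  refine Finset.card_bij (fun a ha ↦
    { parts := doubleAdd a.1 a.2.parts
      parts_pos := fun {i} hi ↦ ?_
      parts_sum := ?_ }) ?_ ?_ ?_
  · rcases mem_doubleAdd.mp hi with h | h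
    · exact a.2.parts_pos h
    · omega
  · have := (key a ha).1
    rw [sum_doubleAdd, a.2.parts_sum]
    omega
  · intro a ha
    rw [Finset.mem_filter]
    exact ⟨Finset.mem_univ _, isEOBar_of_parts_eq rfl (key a ha).2⟩
  · rintro ⟨m, μ⟩ ha ⟨m', μ'⟩ ha' h
    have hparts : doubleAdd m μ.parts = doubleAdd m' μ'.parts := congrArg Nat.Partition.parts h
    -- Both data describe the same partition, whose largest even part determines m.
    have h1 := isLargestEvenPart_iff_of_parts_eq (p := ⟨doubleAdd m μ.parts, by
      intro i hi
      rcases mem_doubleAdd.mp hi with h | h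
      · exact μ.parts_pos h
      · omega, rfl⟩) rfl (key _ ha).2
    have h2 := isLargestEvenPart_iff_of_parts_eq (p := ⟨doubleAdd m μ.parts, by
      intro i hi
      rcases mem_doubleAdd.mp hi with h | h
      · exact μ.parts_pos h
      · omega, rfl⟩) hparts (key _ ha').2
    have hmm : m = m' := by
      have e1 := (h1 (2 * m)).symm.trans (h2 (2 * m))
      have e2 := (h1 (2 * m')).symm.trans (h2 (2 * m'))
      by_cases hm : m = 0
      · by_contra hne
        have := (e2.mpr ⟨by omega, rfl⟩).1
        omega
      · have := (e1.mp ⟨hm, rfl⟩).2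
        omega
    subst hmm
    have : μ = μ' := by
      refine Nat.Partition.ext (Multiset.ext.mpr fun i ↦ ?_)
      have := congrArg (Multiset.count i) hparts
      rw [count_doubleAdd, count_doubleAdd] at this
      omega
    rw [this]
  · intro p hp
    obtain ⟨m, s, hps, hs⟩ := (Finset.mem_filter.mp hp).2.exists_parts_eq
    have hsum := p.parts_sum
    rw [hps, sum_doubleAdd] at hsum
    refine ⟨⟨m, ⟨s, fun {i} hi ↦ p.parts_pos (i := i) ?_, by omega⟩⟩, ?_, ?_⟩
    · rw [hps, mem_doubleAdd]; exact .inl hi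
    · simp only [Finset.mem_sigma, Finset.mem_range, Nat.Partition.restricted, Finset.mem_filter,
        Finset.mem_univ, true_and]
      exact ⟨by omega, hs⟩
    · exact Nat.Partition.ext hps.symm

/-! ### Andrews's product formula -/

namespace PowerSeries

open WithPiTopology Finset

/-- The generating function of the partitions with all parts satisfying `p`. -/
noncomputable def restrictedSeries (p : ℕ → Prop) [DecidablePred p] : ℤ⟦X⟧ :=
  mk fun n ↦ ((Nat.Partition.restricted n p).card : ℤ)

theorem hasProd_restrictedSeries (p : ℕ → Prop) [DecidablePred p] :
    HasProd (fun i ↦ if p (i + 1) then ∑' j : ℕ, (X : ℤ⟦X⟧) ^ ((i + 1) * j) else 1)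
      (restrictedSeries p) :=
  Nat.Partition.hasProd_powerSeriesMk_card_restricted ℤ p

theorem tsum_X_pow_mul_mul_one_sub (i : ℕ) :
    (∑' j : ℕ, (X : ℤ⟦X⟧) ^ ((i + 1) * j)) * (1 - X ^ (i + 1)) = 1 := by
  simp_rw [pow_mul]
  exact tsum_pow_mul_one_sub_of_constantCoeff_eq_zero (by simp)

theorem restrictedSeries_mul_one_sub_X_pow {p q : ℕ → Prop} [DecidablePred p] [DecidablePred q]
    {a : ℕ} (ha : a ≠ 0) (hp : p a) (hq : ¬ q a) (h : ∀ i, i ≠ a → (p i ↔ q i)) :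
    restrictedSeries p * (1 - X ^ a) = restrictedSeries q := by
  obtain ⟨b, rfl⟩ := Nat.exists_eq_succ_of_ne_zero ha
  have h1 := (hasProd_restrictedSeries p).mul
    (hasProd_ite_eq b (1 - X ^ (b + 1) : ℤ⟦X⟧))
  refine h1.unique ((hasProd_restrictedSeries q).congr_fun fun i ↦ ?_)
  by_cases hi : i = b
  · subst hi
    rw [if_neg hq, if_pos hp, if_pos rfl, tsum_X_pow_mul_mul_one_sub]
  · rw [if_neg hi, mul_one]
    simp only [h (i + 1) (by simpa using hi)]

/-- Passing from m to m + 1 admits the part 2m + 2 and forbids 2m + 1, so both sides count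
partitions avoiding both. -/
theorem restrictedSeries_isPairPart_succ (m : ℕ) :
    restrictedSeries (IsPairPart (m + 1)) * (1 - X ^ (2 * m + 2)) =
      restrictedSeries (IsPairPart m) * (1 - X ^ (2 * m + 1)) := by
  rw [restrictedSeries_mul_one_sub_X_pow (a := 2 * m + 2)
      (q := fun i ↦ IsPairPart m i ∧ i ≠ 2 * m + 1) (by omega),
    restrictedSeries_mul_one_sub_X_pow (a := 2 * m + 1)
      (q := fun i ↦ IsPairPart m i ∧ i ≠ 2 * m + 1) (by omega)]
  · simp only [IsPairPart, Nat.even_iff, Nat.odd_iff]; omega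
  · simp
  · intro i hi; simp [hi]
  · simp only [IsPairPart, Nat.even_iff, Nat.odd_iff]; omega
  · simp only [IsPairPart, Nat.even_iff, Nat.odd_iff]; omega
  · intro i hi; simp only [IsPairPart, Nat.even_iff, Nat.odd_iff]; omega

/-- For m = 0 the allowed positive parts are the odd ones; the factors of f at odd exponents cancel.
-/
theorem restrictedSeries_odd_mul :
    restrictedSeries (IsPairPart 0) * pentagonalSeries ℤ =
      expand 2 two_ne_zero (pentagonalSeries ℤ) := by
  have h1 := ((hasProd_restrictedSeries (IsPairPart 0)).mul
    (hasProd_one_sub_X_pow ℤ)).tendsto_prod_nat.comp (tendsto_id.const_mul_atTop' two_pos)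
  refine tendsto_nhds_unique h1 (tendsto_prod_one_sub_X_pow_even.congr fun n ↦ ?_)
  simp only [Function.comp_apply, id]
  induction n with
  | zero => simp
  | succ n ih =>
    rw [show 2 * (n + 1) = 2 * n + 1 + 1 by ring, prod_range_succ, prod_range_succ,
      prod_range_succ, ih, if_pos, if_neg, tsum_X_pow_mul_mul_one_sub]
    · ring
    · simp only [IsPairPart, Nat.even_iff, Nat.odd_iff]; omega
    · simp only [IsPairPart, Nat.even_iff, Nat.odd_iff]; omega

/-- The generating function of the pairs in `IsEOBar` partitions, weighted by the largest
even part. -/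
noncomputable def pairSeries (k : ℕ) : ℤ⟦X⟧ :=
  ∑' m : ℕ, X ^ ((2 * k + 1) * m) * restrictedSeries (IsPairPart m)

theorem summable_X_pow_mul {f : ℕ → ℕ} (hf : ∀ m, m ≤ f m) (g : ℕ → ℤ⟦X⟧) :
    Summable fun m ↦ X ^ f m * g m := by
  rw [summable_iff_summable_coeff]
  intro d
  refine summable_of_ne_finset_zero (s := range (d + 1)) fun m hm ↦ ?_
  rw [mem_range] at hm
  rw [coeff_X_pow_mul', if_neg]
  have := hf m
  omega

theorem le_odd_mul (k m : ℕ) : m ≤ (2 * k + 1) * m := Nat.le_mul_of_pos_left _ (by omega)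

/-- The parameter k exists for this recursion: it moves the wanted series at k = 0 towards k → ∞,
where only m = 0 survives. The two differences `h1` and `h2` are the same sum up to a shift of m,
whose missing term at m = 0 contains 1 - X^0 = 0. -/
theorem one_sub_mul_pairSeries (k : ℕ) :
    (1 - X ^ (2 * k + 1)) * pairSeries k = (1 - X ^ (2 * k + 2)) * pairSeries (k + 1) := by
  set R : ℕ → ℤ⟦X⟧ := fun m ↦ restrictedSeries (IsPairPart m) with hR
  have hs (k : ℕ) : Summable fun m ↦ X ^ ((2 * k + 1) * m) * R m :=
    summable_X_pow_mul (le_odd_mul k) R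
  have h1 : pairSeries k - pairSeries (k + 1) =
      ∑' m : ℕ, X ^ ((2 * k + 1) * m) * ((1 - X ^ (2 * m)) * R m) := by
    rw [pairSeries, pairSeries, ← (hs k).tsum_sub (hs (k + 1))]
    refine tsum_congr fun m ↦ ?_
    ring
  have h2 : X ^ (2 * k + 1) * pairSeries k - X ^ (2 * k + 2) * pairSeries (k + 1) =
      ∑' m : ℕ, X ^ ((2 * k + 1) * (m + 1)) * ((1 - X ^ (2 * (m + 1))) * R (m + 1)) := by
    rw [pairSeries, pairSeries, ← (hs k).tsum_mul_left, ← (hs (k + 1)).tsum_mul_left,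
      ← ((hs k).mul_left _).tsum_sub ((hs (k + 1)).mul_left _)]
    refine tsum_congr fun m ↦ ?_
    have := restrictedSeries_isPairPart_succ m
    linear_combination (-X ^ ((2 * k + 1) * (m + 1))) * this
  have h3 := (summable_X_pow_mul (le_odd_mul k) fun m ↦ (1 - X ^ (2 * m)) * R m).tsum_eq_zero_add
  simp only [mul_zero, pow_zero, sub_self, zero_mul, mul_zero, zero_add] at h3
  linear_combination h1 - h2 + h3

theorem pairSeries_zero_mul_prod (n : ℕ) :
    pairSeries 0 * ∏ j ∈ range n, (1 - X ^ (2 * j + 1)) =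
      pairSeries n * ∏ j ∈ range n, (1 - X ^ (2 * j + 2)) := by
  induction n with
  | zero => simp
  | succ n ih =>
    rw [prod_range_succ, prod_range_succ, ← mul_assoc, ih]
    linear_combination (∏ j ∈ range n, (1 - X ^ (2 * j + 2))) * one_sub_mul_pairSeries n

theorem tendsto_pairSeries :
    Tendsto pairSeries atTop (𝓝 (restrictedSeries (IsPairPart 0))) := by
  have h (k : ℕ) : pairSeries k = restrictedSeries (IsPairPart 0) +
      X ^ k * ∑' m : ℕ, X ^ (k * (m + 1) + (m + 1) + k * m) *
        restrictedSeries (IsPairPart (m + 1)) := by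
    rw [pairSeries, (summable_X_pow_mul (le_odd_mul k) _).tsum_eq_zero_add,
      ← (summable_X_pow_mul (fun m ↦ by nlinarith) _).tsum_mul_left]
    congr 1
    · simp
    · refine tsum_congr fun m ↦ ?_
      ring
  have := (tendsto_zero_of_X_pow_dvd (u := fun k ↦ X ^ k * ∑' m : ℕ,
    X ^ (k * (m + 1) + (m + 1) + k * m) * restrictedSeries (IsPairPart (m + 1)))
    fun k ↦ dvd_mul_right _ _).const_add (restrictedSeries (IsPairPart 0))
  rw [add_zero] at this
  exact this.congr fun k ↦ (h k).symm

/-- The generating function of `EOBar` at even numbers. -/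
noncomputable def eoBarSeries : ℤ⟦X⟧ := mk fun n ↦ (EOBar (2 * n) : ℤ)

theorem pairSeries_zero : pairSeries 0 = eoBarSeries := by
  ext n
  have hs := summable_X_pow_mul (le_odd_mul 0) fun m ↦ restrictedSeries (IsPairPart m)
  rw [pairSeries, hs.map_tsum _ (continuous_coeff ℤ n), tsum_eq_sum (s := range (n + 1)),
    eoBarSeries, coeff_mk, eoBar_two_mul, Nat.cast_sum]
  · refine sum_congr rfl fun m hm ↦ ?_
    rw [mem_range] at hm
    rw [coeff_X_pow_mul', if_pos (by omega), restrictedSeries, coeff_mk,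
      show n - (2 * 0 + 1) * m = n - m by omega]
  · intro m hm
    rw [mem_range] at hm
    rw [coeff_X_pow_mul', if_neg (by omega)]

/-- Andrews's product formula for the generating function of `EOBar`. -/
theorem eoBarSeries_mul_pentagonalSeries_sq :
    eoBarSeries * pentagonalSeries ℤ ^ 2 = expand 2 two_ne_zero (pentagonalSeries ℤ) ^ 3 := by
  have h1 := tendsto_prod_odd_mul_prod_even.const_mul eoBarSeries
  have h2 := (tendsto_pairSeries.mul tendsto_prod_one_sub_X_pow_even).mul
    tendsto_prod_one_sub_X_pow_even
  have h3 : eoBarSeries * pentagonalSeries ℤ = restrictedSeries (IsPairPart 0) *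
      expand 2 two_ne_zero (pentagonalSeries ℤ) * expand 2 two_ne_zero (pentagonalSeries ℤ) := by
    refine tendsto_nhds_unique h1 (h2.congr fun n ↦ ?_)
    rw [← pairSeries_zero_mul_prod, pairSeries_zero, mul_assoc]
  linear_combination (pentagonalSeries ℤ) * h3 +
    expand 2 two_ne_zero (pentagonalSeries ℤ) ^ 2 * restrictedSeries_odd_mul

end PowerSeries

/-! ### Reduction modulo 8 and modulo 2 -/

namespace PowerSeries

open Finset

/-- Reduction of the coefficients modulo two. -/
noncomputable abbrev modTwo : ℤ⟦X⟧ →+* (ZMod 2)⟦X⟧ := map (Int.castRingHom (ZMod 2))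

theorem expand_two_eq_sq (g : (ZMod 2)⟦X⟧) : expand 2 two_ne_zero g = g ^ 2 := by
  have h : map (frobenius (ZMod 2) 2) (expand 2 two_ne_zero g) = g ^ 2 :=
    MvPowerSeries.map_frobenius_expand 2 two_ne_zero
  rwa [ZMod.frobenius_zmod, map_id] at h

theorem expand_two_pow_eq_pow (k : ℕ) (g : (ZMod 2)⟦X⟧) :
    expand (2 ^ k) (pow_ne_zero k two_ne_zero) g = g ^ 2 ^ k := by
  induction k with
  | zero => simp
  | succ k ih =>
    have h := expand_mul 2 two_ne_zero (2 ^ k) (pow_ne_zero k two_ne_zero) g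
    rw [ih, expand_two_eq_sq, ← pow_mul] at h
    simpa only [← pow_succ', ← pow_succ] using h

/-- Squaring is the Frobenius modulo 2. -/
theorem exists_sq_eq_expand_add (g : ℤ⟦X⟧) : ∃ b, g ^ 2 = expand 2 two_ne_zero g + 2 * b := by
  have h (n : ℕ) : (2 : ℤ) ∣ coeff n (g ^ 2 - expand 2 two_ne_zero g) := by
    have h1 : modTwo (g ^ 2 - expand 2 two_ne_zero g) = 0 := by
      rw [map_sub, map_pow, map_expand, expand_two_eq_sq, sub_self]
    have h2 := congrArg (coeff n) h1
    rw [coeff_map, map_zero] at h2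
    exact (ZMod.intCast_zmod_eq_zero_iff_dvd _ 2).mp h2
  choose b hb using h
  refine ⟨mk b, ?_⟩
  rw [← sub_eq_iff_eq_add']
  ext n
  rw [hb, show (2 : ℤ⟦X⟧) = C 2 by simp, coeff_C_mul, coeff_mk]

theorem coeff_two_mul_add_one_expand (g : ℤ⟦X⟧) (n : ℕ) :
    coeff (2 * n + 1) (expand 2 two_ne_zero g) = 0 :=
  coeff_expand_of_not_dvd _ _ _ (by omega)

theorem coeff_two_mul_add_one_X_mul_expand (g : ℤ⟦X⟧) (n : ℕ) :
    coeff (2 * n + 1) (X * expand 2 two_ne_zero g) = coeff n g := by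
  rw [coeff_succ_X_mul, coeff_expand_mul]

/-- The odd squares are `1` plus eight times the triangular numbers. -/
theorem exists_squareSeries_eq : ∃ b, squareSeries = expand 2 two_ne_zero b +
    X * expand 2 two_ne_zero (expand 4 four_ne_zero triangleSeries) := by
  refine ⟨mk fun n ↦ coeff (2 * n) squareSeries, ?_⟩
  ext n
  obtain ⟨m, rfl | rfl⟩ := Nat.even_or_odd' n
  · rw [map_add, coeff_expand_mul, coeff_mk, left_eq_add]
    rcases m with _ | m
    · simp
    · rw [show 2 * (m + 1) = 2 * m + 1 + 1 by ring, coeff_succ_X_mul,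
        coeff_two_mul_add_one_expand]
  · rw [map_add, coeff_two_mul_add_one_expand, coeff_two_mul_add_one_X_mul_expand, zero_add,
      coeff_expand, squareSeries, coeff_mk]
    have hsign : (-1 : ℤ) ^ (2 * m + 1 + 1) = 1 := Even.neg_one_pow ⟨m + 1, by ring⟩
    rw [hsign]
    simp only [triangleSeries, coeff_mk]
    by_cases h4 : 4 ∣ m
    · obtain ⟨t, rfl⟩ := h4
      rw [if_pos (dvd_mul_right _ _), Nat.mul_div_cancel_left _ four_pos]
      simp [← mul_assoc]
    · rw [if_neg h4, if_neg]
      rintro ⟨⟨r, hr⟩, -⟩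
      obtain ⟨k, rfl⟩ : Odd r := by
        have : Odd (r * r) := by rw [← hr]; exact ⟨m, rfl⟩
        exact (Nat.odd_mul.mp this).1
      obtain ⟨s, hs⟩ := Nat.even_mul_succ_self k
      apply h4
      exact ⟨s, by linarith⟩

theorem pentagonalSeries_int_ne_zero : pentagonalSeries ℤ ≠ 0 := by
  intro h
  have h1 : coeff (pentagonal 0) (pentagonalSeries ℤ) = 0 := by rw [h, map_zero]
  rw [coeff_pentagonalSeries_pentagonal] at h1
  simp at h1

theorem eoBarSeries_mul_one_sub :
    eoBarSeries * (1 - 2 * squareSeries) = expand 2 two_ne_zero (pentagonalSeries ℤ) ^ 2 := by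
  have h0 : expand 2 two_ne_zero (pentagonalSeries ℤ) ≠ 0 := by
    intro h
    apply pow_ne_zero 2 pentagonalSeries_int_ne_zero
    rw [← one_sub_two_mul_squareSeries_mul, h, mul_zero]
  refine mul_right_cancel₀ h0 ?_
  rw [mul_assoc, one_sub_two_mul_squareSeries_mul, eoBarSeries_mul_pentagonalSeries_sq]
  ring

/-- The coefficients of the `EOBar` series at the indices `4 * k + 3`, modulo eight. -/
theorem exists_coeff_eoBarSeries_eq (k : ℕ) : ∃ c, coeff (4 * k + 3) eoBarSeries =
    -4 * coeff k (pentagonalSeries ℤ * expand 2 two_ne_zero triangleSeries *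
      expand 4 four_ne_zero triangleSeries) + 8 * c := by
  set f := pentagonalSeries ℤ
  set a := squareSeries
  obtain ⟨b, hb⟩ := exists_sq_eq_expand_add a
  obtain ⟨e, he⟩ := exists_squareSeries_eq
  -- This is f(q^2)^2 (1 + 2a + 4a^2) + 8a^3 E, where 4a^2 is 4a(q^2) up to a multiple of 8 and the
  -- odd part of a is qψ(q^8).
  have h1 : eoBarSeries = expand 2 two_ne_zero (f ^ 2 * (1 + 4 * a + 2 * e)) +
      C 2 * (X * expand 2 two_ne_zero (f ^ 2 * expand 4 four_ne_zero triangleSeries)) +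
      C 8 * (eoBarSeries * a ^ 3 + expand 2 two_ne_zero f ^ 2 * b) := by
    have h := eoBarSeries_mul_one_sub
    simp only [map_mul, map_add, map_one, map_pow, map_ofNat]
    linear_combination (1 + 2 * a + 4 * a ^ 2) * h + 4 * expand 2 two_ne_zero f ^ 2 * hb +
      2 * expand 2 two_ne_zero f ^ 2 * he
  -- The second split uses f^2 = (1 - 2a) f(q^2), so that the odd exponents again come only from a.
  have h2 : f ^ 2 * expand 4 four_ne_zero triangleSeries =
      expand 2 two_ne_zero (f * expand 2 two_ne_zero triangleSeries * (1 - 2 * e)) +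
      C (-2) * (X * expand 2 two_ne_zero (f * expand 2 two_ne_zero triangleSeries *
        expand 4 four_ne_zero triangleSeries)) := by
    have h := one_sub_two_mul_squareSeries_mul
    have h4 : expand 4 four_ne_zero triangleSeries =
        expand 2 two_ne_zero (expand 2 two_ne_zero triangleSeries) :=
      expand_mul 2 two_ne_zero 2 two_ne_zero triangleSeries
    rw [h4, ← h]
    rw [h4] at he
    simp only [map_mul, map_sub, map_one, map_neg, map_ofNat]
    rw [he]
    ring
  refine ⟨coeff (2 * (2 * k + 1) + 1) (eoBarSeries * a ^ 3 + expand 2 two_ne_zero f ^ 2 * b), ?_⟩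
  rw [show 4 * k + 3 = 2 * (2 * k + 1) + 1 by ring]
  conv_lhs => rw [h1]
  rw [map_add, map_add, coeff_two_mul_add_one_expand, coeff_C_mul, coeff_C_mul,
    coeff_two_mul_add_one_X_mul_expand, h2, map_add, coeff_two_mul_add_one_expand, coeff_C_mul,
    coeff_two_mul_add_one_X_mul_expand]
  ring

/-- Gauss's identity f ψ = f(q^2)^2 becomes f ψ ≡ f^4. -/
theorem modTwo_triangleSeries : modTwo triangleSeries = modTwo (pentagonalSeries ℤ) ^ 3 := by
  have h := congrArg modTwo pentagonalSeries_mul_triangleSeries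
  rw [map_mul, map_pow, map_expand, expand_two_eq_sq] at h
  have h0 : modTwo (pentagonalSeries ℤ) ≠ 0 := by
    intro h
    have h1 : coeff (pentagonal 0) (modTwo (pentagonalSeries ℤ)) = 0 := by rw [h, map_zero]
    rw [coeff_map, coeff_pentagonalSeries_pentagonal] at h1
    simp at h1
  refine mul_left_cancel₀ h0 ?_
  rw [h]; ring

/-- Both sides are f^19: f · f^6 · f^12 on the left and f^3 · f^16 on the right. -/
theorem modTwo_pentagonalSeries_mul :
    modTwo (pentagonalSeries ℤ * expand 2 two_ne_zero triangleSeries *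
      expand 4 four_ne_zero triangleSeries) =
    modTwo triangleSeries *
      expand (2 ^ 4) (pow_ne_zero 4 two_ne_zero) (modTwo (pentagonalSeries ℤ)) := by
  have h4 := expand_two_pow_eq_pow 2 (modTwo triangleSeries)
  rw [map_mul, map_mul, map_expand, map_expand, expand_two_eq_sq, expand_two_pow_eq_pow]
  refine (congrArg _ h4).trans ?_
  rw [modTwo_triangleSeries]
  ring

theorem modTwo_eoBarSeries : modTwo eoBarSeries =
    expand (2 ^ 2) (pow_ne_zero 2 two_ne_zero) (modTwo (pentagonalSeries ℤ)) := by
  have h := congrArg modTwo eoBarSeries_mul_one_sub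
  have h2 : (2 : (ZMod 2)⟦X⟧) = 0 := by
    rw [← map_ofNat C 2, show (OfNat.ofNat 2 : ZMod 2) = 0 from rfl, map_zero]
  rw [map_mul, map_sub, map_mul, map_ofNat modTwo 2, h2, zero_mul, map_one, sub_zero, mul_one, map_pow,
    map_expand, expand_two_eq_sq] at h
  rw [h, expand_two_pow_eq_pow]
  ring

theorem exists_eq_of_coeff_expand_modTwo_pentagonalSeries_ne_zero {p : ℕ} (hp : p ≠ 0) {n : ℕ}
    (h : coeff n (expand p hp (modTwo (pentagonalSeries ℤ))) ≠ 0) :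
    ∃ t, n = p * pentagonal t := by
  rw [coeff_expand] at h
  split_ifs at h with hd
  · obtain ⟨m, rfl⟩ := hd
    rw [Nat.mul_div_cancel_left _ (Nat.pos_of_ne_zero hp), coeff_map] at h
    by_cases hm : m ∈ Set.range pentagonal
    · obtain ⟨t, rfl⟩ := hm
      exact ⟨t, rfl⟩
    · rw [coeff_pentagonalSeries_eq_zero _ hm, map_zero] at h
      exact absurd rfl h
  · exact absurd rfl h

end PowerSeries

open PowerSeries

/-! ### Exceptional indices and density -/

theorem exists_of_not_even_eoBar {n : ℕ} (h : ¬ Even (EOBar (2 * n))) :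
    ∃ x z : ℤ, ((6 : ℕ) * n + (1 : ℕ) : ℤ) = z ^ 2 + 3 * x ^ 2 := by
  have h1 : coeff n (modTwo eoBarSeries) ≠ 0 := by
    rw [coeff_map, eoBarSeries, coeff_mk]
    intro h0
    apply h
    rw [← Int.even_coe_nat, even_iff_two_dvd]
    exact (ZMod.intCast_zmod_eq_zero_iff_dvd _ 2).mp h0
  rw [modTwo_eoBarSeries] at h1
  obtain ⟨t, rfl⟩ := exists_eq_of_coeff_expand_modTwo_pentagonalSeries_ne_zero _ h1
  -- With n = 2t(3t - 1), 6n + 1 is the square of 6t - 1.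
  refine ⟨0, 6 * t - 1, ?_⟩
  have := two_mul_natCast_pentagonal t
  push_cast
  linear_combination 12 * this

theorem exists_of_not_eoBar_modEq_zero {n : ℕ} (h : ¬ EOBar (8 * n + 6) ≡ 0 [MOD 8]) :
    ∃ x z : ℤ, ((24 : ℕ) * n + (19 : ℕ) : ℤ) = z ^ 2 + 3 * x ^ 2 := by
  obtain ⟨c, hc⟩ := exists_coeff_eoBarSeries_eq n
  set g := pentagonalSeries ℤ * expand 2 two_ne_zero triangleSeries *
    expand 4 four_ne_zero triangleSeries with hg
  have h1 : coeff n (modTwo g) ≠ 0 := by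
    rw [coeff_map]
    intro h0
    obtain ⟨d, hd⟩ := (ZMod.intCast_zmod_eq_zero_iff_dvd _ 2).mp h0
    apply h
    rw [hd, eoBarSeries, coeff_mk, show 2 * (4 * n + 3) = 8 * n + 6 by ring] at hc
    rw [Nat.modEq_zero_iff_dvd]
    have : (8 : ℤ) ∣ EOBar (8 * n + 6) := ⟨c - d, by rw [hc]; push_cast; ring⟩
    exact_mod_cast this
  rw [hg, modTwo_pentagonalSeries_mul, coeff_mul] at h1
  obtain ⟨⟨i, j⟩, hij, hne⟩ := Finset.exists_ne_zero_of_sum_ne_zero h1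
  rw [Finset.HasAntidiagonal.mem_antidiagonal] at hij
  obtain ⟨hi, hj⟩ := mul_ne_zero_iff.mp hne
  obtain ⟨t, ht⟩ := exists_eq_of_coeff_expand_modTwo_pentagonalSeries_ne_zero _ hj
  obtain ⟨r, hr⟩ : IsSquare (8 * i + 1) := by
    by_contra hsq
    apply hi
    rw [coeff_map, triangleSeries, coeff_mk, if_neg hsq, map_zero]
  -- With n = i + 16P for a pentagonal number P, 24n + 19 = 3(8i + 1) + 16(24P + 1), and 24P + 1 =
  -- (6t - 1)^2.
  refine ⟨r, 4 * (6 * t - 1), ?_⟩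
  have h2 := two_mul_natCast_pentagonal t
  have h3 : (8 * i + 1 : ℤ) = r * r := mod_cast hr
  have h4 : (i + 2 ^ 4 * pentagonal t : ℤ) = n := by simp only at hij ht; rw [← hij, ht]; push_cast; ring
  push_cast
  linear_combination -24 * h4 + 3 * h3 + 192 * h2

/-- If the complement of `P` has density zero, then `P` holds for almost all natural numbers. -/
theorem tendsto_ncard_div_of_density_zero {P : ℕ → Prop}
    (h : ∀ ε : ℝ, 0 < ε → ∀ᶠ N : ℕ in atTop, (({n | ¬ P n} ∩ Set.Iio N).ncard : ℝ) ≤ ε * N) :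
    Tendsto (fun X : ℝ ↦ (Set.ncard {n : ℕ | (n : ℝ) ≤ X ∧ P n} : ℝ) / X) atTop (𝓝 1) := by
  set c : ℕ → ℝ := fun N ↦ (({n | ¬ P n} ∩ Set.Iio N).ncard : ℝ) with hc
  have h1 : Tendsto (fun N : ℕ ↦ c N / N) atTop (𝓝 0) := by
    rw [Metric.tendsto_nhds]
    intro ε hε
    filter_upwards [h (ε / 2) (half_pos hε), eventually_gt_atTop 0] with N hN hN0
    have hN0' : (0 : ℝ) < N := mod_cast hN0
    have hcN : 0 ≤ c N := Nat.cast_nonneg _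
    rw [Real.dist_eq, sub_zero, abs_of_nonneg (by positivity), div_lt_iff₀ hN0']
    have : c N ≤ ε / 2 * N := hN
    nlinarith
  -- For X ≥ 0 this is the number of n with 0 ≤ n ≤ X, zero included.
  set N : ℝ → ℕ := fun X ↦ ⌊X⌋₊ + 1 with hN
  have h2 : Tendsto (fun X : ℝ ↦ (N X : ℝ) / X) atTop (𝓝 1) := by
    have := (tendsto_nat_floor_div_atTop (R := ℝ)).add tendsto_inv_atTop_zero
    rw [add_zero] at this
    refine this.congr fun X ↦ ?_
    simp only [hN]; push_cast; rw [add_div, one_div]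
  have h3 : Tendsto N atTop atTop := (tendsto_add_atTop_nat 1).comp tendsto_nat_floor_atTop
  have h4 := h2.sub ((h1.comp h3).mul h2)
  rw [zero_mul, sub_zero] at h4
  refine h4.congr' ?_
  filter_upwards [eventually_ge_atTop 0] with X hX
  have hset : {n : ℕ | (n : ℝ) ≤ X ∧ P n} = Set.Iio (N X) \ ({n | ¬ P n} ∩ Set.Iio (N X)) := by
    ext n
    simp only [Set.mem_ofPred_eq, Set.mem_sdiff, Set.mem_inter_iff, Set.mem_Iio, hN,
      Nat.lt_succ_iff, Nat.le_floor_iff hX]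
    tauto
  have hcard : (Set.ncard {n : ℕ | (n : ℝ) ≤ X ∧ P n} : ℝ) = N X - c (N X) := by
    rw [hset, Set.ncard_sdiff Set.inter_subset_right ((Set.finite_Iio _).inter_of_right _),
      Nat.cast_sub (Set.ncard_le_ncard Set.inter_subset_right (Set.finite_Iio _))]
    simp [Set.ncard_eq_toFinset_card', hc]
  have hNX : (N X : ℝ) ≠ 0 := by simp only [hN]; positivity
  rw [hcard, sub_div, Function.comp_apply, div_mul_div_comm, mul_comm (N X : ℝ) X,
    mul_div_mul_right _ _ hNX]

theorem theorem1p5 :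
    Tendsto (fun X : ℝ =>
        (Set.ncard {n : ℕ | (n : ℝ) ≤ X ∧ EOBar (8 * n + 6) ≡ 0 [MOD 8]} : ℝ) / X)
      atTop (𝓝 1) ∧
    Tendsto (fun X : ℝ =>
        (Set.ncard {n : ℕ | (n : ℝ) ≤ X ∧ Even (EOBar (2 * n))} : ℝ) / X)
      atTop (𝓝 1) :=
  ⟨tendsto_ncard_div_of_density_zero fun _ hε ↦ eventually_card_sq_add_three_mul_sq_le
      (by norm_num) _ (fun _ hn ↦ exists_of_not_eoBar_modEq_zero hn) hε,
    tendsto_ncard_div_of_density_zero fun _ hε ↦ eventually_card_sq_add_three_mul_sq_le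
      (by norm_num) _ (fun _ hn ↦ exists_of_not_even_eoBar hn) hε⟩
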